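/- Let $\tau=\frac{\sqrt5-1}{2}$, and let $F_\tau$ be Cleary's golden ratio Thompson group: the group of orientation-preserving piecewise linear homeomorphisms $g$ of $[0,1]$ such that $g$ has finitely many breakpoints, all of which lie in $\mathbb{Z}[\tau]$, and the slope of $g$, whenever it is defined, is an integer power of $\tau$. Let $F_\tau'=[F_\tau,F_\tau]$ be its commutator subgroup. Then: 1. $F_\tau'$ is $6$-uniformly simple: for all $f,g\in F_\tau'\setminus\{\mathrm{id}\}$, the element $f$ is a product of at most $6$ elements, each of which is a conjugate, by an element of $F_\tau'$, of $g$ or of $g^{-1}$. 2. $F_\tau'$ is $2$-uniformly perfect: every $f\in F_\tau'\setminus\{\mathrm{id}\}$ is a product of at most $2$ commutators $[a,b]$ with $a,b\in F_\tau'$. -/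

import Mathlib

/-- The small golden ratio `τ = (√5 - 1) / 2`. -/
noncomputable def tau : ℝ := (Real.sqrt 5 - 1) / 2

/-- The ring `ℤ[τ]`, as a subring of `ℝ`. -/
noncomputable def ZTau : Subalgebra ℤ ℝ := Algebra.adjoin ℤ {tau}

/-- `g` is piecewise linear with finitely many breakpoints, all of them in `ℤ[τ]`, and all its
slopes are powers of `τ` with integer exponent: there is a finite set `S ⊆ ℤ[τ] ∩ [0, 1]` such
that on every interval `[a, b]` without a point of `S` in its interior, `g` is affine with slope
`τ ^ k` for some `k : ℤ`. -/
def IsPiecewiseTau (g : unitInterval → unitInterval) : Prop :=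
  ∃ S : Finset unitInterval, (∀ s ∈ S, (s : ℝ) ∈ ZTau) ∧
    ∀ a b : unitInterval, a < b → (∀ s ∈ S, ¬ (a < s ∧ s < b)) →
      ∃ (k : ℤ) (c : ℝ), ∀ x ∈ Set.Icc a b, (g x : ℝ) = tau ^ k * (x : ℝ) + c

theorem tau_pos : 0 < tau := by
  have : (1 : ℝ) < Real.sqrt 5 := by
    rw [Real.lt_sqrt] <;> norm_num
  unfold tau
  linarith

theorem tau_mul : tau * (tau + 1) = 1 := by
  have := Real.sq_sqrt (show (0 : ℝ) ≤ 5 by norm_num)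
  unfold tau
  nlinarith

theorem tau_mem : tau ∈ ZTau := Algebra.subset_adjoin rfl

theorem tau_zpow_mem (k : ℤ) : tau ^ k ∈ ZTau := by
  have hi : tau⁻¹ ∈ ZTau := by
    rw [inv_eq_of_mul_eq_one_right tau_mul]
    exact ZTau.add_mem tau_mem ZTau.one_mem
  obtain ⟨n, rfl | rfl⟩ := k.eq_nat_or_neg
  · rw [zpow_natCast]
    exact ZTau.pow_mem tau_mem n
  · rw [zpow_neg, zpow_natCast, ← inv_pow]
    exact ZTau.pow_mem hi n

theorem tau_zpow_mul_mem_iff (k : ℤ) (x : ℝ) : tau ^ k * x ∈ ZTau ↔ x ∈ ZTau := by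
  refine ⟨fun h => ?_, fun h => ZTau.mul_mem (tau_zpow_mem k) h⟩
  have := ZTau.mul_mem (tau_zpow_mem (-k)) h
  rwa [← mul_assoc, ← zpow_add₀ tau_pos.ne', neg_add_cancel, zpow_zero, one_mul] at this

/-- Such a homeomorphism preserves `ℤ[τ] ∩ [0, 1]`. -/
theorem IsPiecewiseTau.mem_iff {g : unitInterval → unitInterval} (hg : IsPiecewiseTau g)
    (h0 : g 0 = 0) (x : unitInterval) : (g x : ℝ) ∈ ZTau ↔ (x : ℝ) ∈ ZTau := by
  classical
  obtain ⟨S, hS, h⟩ := hg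
  have key : ∀ a b : unitInterval, a < b → (∀ s ∈ S, ¬ (a < s ∧ s < b)) →
      (a : ℝ) ∈ ZTau → (g a : ℝ) ∈ ZTau → ((g b : ℝ) ∈ ZTau ↔ (b : ℝ) ∈ ZTau) := by
    intro a b hab hs ha hga
    obtain ⟨k, c, hk⟩ := h a b hab hs
    have e1 := hk a ⟨le_rfl, hab.le⟩
    have e2 := hk b ⟨hab.le, le_rfl⟩
    have e3 : (g b : ℝ) - g a = tau ^ k * ((b : ℝ) - a) := by rw [e1, e2]; ring
    have e4 := tau_zpow_mul_mem_iff k ((b : ℝ) - a)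
    rw [← e3] at e4
    constructor
    · intro hb
      simpa using ZTau.add_mem (e4.1 (ZTau.sub_mem hb hga)) ha
    · intro hb
      simpa using ZTau.add_mem (e4.2 (ZTau.sub_mem hb ha)) hga
  induction hn : (S.filter (fun s => s < x)).card using Nat.strong_induction_on generalizing x with
  | _ n ih =>
    subst hn
    rcases eq_or_lt_of_le (show (0 : unitInterval) ≤ x from unitInterval.nonneg') with rfl | hx
    · rw [h0]
    by_cases hne : (S.filter (fun s => s < x)).Nonempty
    · obtain ⟨m, hm, hmax⟩ := (S.filter (fun s => s < x)).exists_max_image id hne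
      rw [Finset.mem_filter] at hm
      have hmZ := hS m hm.1
      refine key m x hm.2 ?_ hmZ ((ih _ ?_ m rfl).2 hmZ)
      · rintro s hs ⟨h1, h2⟩
        exact absurd (hmax s (Finset.mem_filter.2 ⟨hs, h2⟩)) (not_le.2 h1)
      · apply Finset.card_lt_card
        refine ⟨fun s hs => ?_, fun hsub => ?_⟩
        · rw [Finset.mem_filter] at hs ⊢
          exact ⟨hs.1, hs.2.trans hm.2⟩
        · exact lt_irrefl _ (Finset.mem_filter.1 (hsub (Finset.mem_filter.2 hm))).2
    · refine key 0 x hx ?_ (by simp) (by simp [h0])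
      rintro s hs ⟨-, h2⟩
      exact hne ⟨s, Finset.mem_filter.2 ⟨hs, h2⟩⟩

theorem unitInterval_map_zero {g : unitInterval ≃ₜ unitInterval} (hg : StrictMono g) : g 0 = 0 := by
  apply le_antisymm _ unitInterval.nonneg'
  have := hg.monotone (show 0 ≤ g.symm 0 from unitInterval.nonneg')
  simpa using this

theorem strictMono_symm {g : unitInterval ≃ₜ unitInterval} (hg : StrictMono g) :
    StrictMono g.symm := by
  intro x y hxy
  rw [← hg.lt_iff_lt]
  simpa using hxy

/-- Cleary's golden ratio Thompson group `F_τ`: the group, under composition, of the orientation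
preserving piecewise linear homeomorphisms of `[0, 1]` with finitely many breakpoints, all of
which lie in `ℤ[τ]`, and all of whose slopes are powers of `τ`. -/
def FTau : Subgroup (unitInterval ≃ₜ unitInterval) where
  carrier := {g | StrictMono g ∧ IsPiecewiseTau g}
  one_mem' := by
    refine ⟨strictMono_id, ∅, by simp, fun a b _ _ => ⟨0, 0, fun x _ => ?_⟩⟩
    simp
  mul_mem' := by
    classical
    rintro g f ⟨hg, hgP⟩ ⟨hf, hfP⟩
    have hfmem := hfP.mem_iff (unitInterval_map_zero hf)
    obtain ⟨S, hS, hSg⟩ := hgP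
    obtain ⟨T, hT, hTf⟩ := hfP
    refine ⟨hg.comp hf, T ∪ S.image f.symm, ?_, ?_⟩
    · intro s hs
      rcases Finset.mem_union.1 hs with hs | hs
      · exact hT s hs
      · obtain ⟨t, ht, rfl⟩ := Finset.mem_image.1 hs
        rw [← hfmem]
        simpa using hS t ht
    · intro a b hab hs
      obtain ⟨k, c, hk⟩ := hTf a b hab fun s h => hs s (Finset.mem_union_left _ h)
      obtain ⟨l, d, hl⟩ := hSg (f a) (f b) (hf hab) fun s h hh =>
        hs (f.symm s) (Finset.mem_union_right _ (Finset.mem_image_of_mem _ h))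
          ⟨by rw [← hf.lt_iff_lt]; simpa using hh.1, by rw [← hf.lt_iff_lt]; simpa using hh.2⟩
      refine ⟨l + k, tau ^ l * c + d, fun x hx => ?_⟩
      have := hl (f x) ⟨hf.monotone hx.1, hf.monotone hx.2⟩
      rw [hk x hx] at this
      change (g (f x) : ℝ) = _
      rw [this, zpow_add₀ tau_pos.ne']
      ring
  inv_mem' := by
    classical
    rintro f ⟨hf, hfP⟩
    have hfmem := hfP.mem_iff (unitInterval_map_zero hf)
    obtain ⟨T, hT, hTf⟩ := hfP
    have hf' := strictMono_symm hf
    refine ⟨hf', T.image f, ?_, ?_⟩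
    · intro s hs
      obtain ⟨t, ht, rfl⟩ := Finset.mem_image.1 hs
      exact (hfmem t).2 (hT t ht)
    · intro a b hab hs
      obtain ⟨k, c, hk⟩ := hTf (f.symm a) (f.symm b) (hf' hab) fun s h hh =>
        hs (f s) (Finset.mem_image_of_mem _ h)
          ⟨by simpa using hf hh.1, by simpa using hf hh.2⟩
      refine ⟨-k, -(tau ^ (-k) * c), fun x hx => ?_⟩
      have := hk (f.symm x) ⟨hf'.monotone hx.1, hf'.monotone hx.2⟩
      rw [f.apply_symm_apply] at this
      change (f.symm x : ℝ) = _
      have hne : tau ^ k ≠ 0 := zpow_ne_zero _ tau_pos.ne'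
      rw [this, zpow_neg]
      field_simp
      ring

/-- `G` is `n`-uniformly simple: for all nontrivial `f, g`, the element `f` is a product of at most
`n` conjugates (in `G`) of `g` and `g⁻¹`. -/
def IsUniformlySimple (n : ℕ) (G : Type*) [Group G] : Prop :=
  ∀ f g : G, f ≠ 1 → g ≠ 1 →
    ∃ l : List G, l.length ≤ n ∧ (∀ h ∈ l, IsConj g h ∨ IsConj g⁻¹ h) ∧ l.prod = f

/-- `G` is `n`-uniformly perfect: every nontrivial `f` is a product of at most `n` commutators of
elements of `G`. -/
def IsUniformlyPerfect (n : ℕ) (G : Type*) [Group G] : Prop :=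
  ∀ f : G, f ≠ 1 →
    ∃ l : List G, l.length ≤ n ∧ (∀ h ∈ l, ∃ a b : G, h = a * b * a⁻¹ * b⁻¹) ∧ l.prod = f

/-! The argument has a dynamical half and a half specific to `F_τ`. Let `Γ` act faithfully and by
order-preserving maps on a linear order, every element having bounded support, and suppose that any
interval can be stretched over any other. Supports can then be displaced off themselves, so
correction terms can be moved to where they commute with everything relevant. This makes `Γ'`
perfect, and it lets an arbitrary product of commutators collapse to `⁅φ, t⁆ * ⁅a, b⁆`, where `t` is
any element displacing the supports (`exists_eq_commutator_mul_commutator`). Given `g ≠ 1`, such a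
`t` exists among the conjugates of `g` or `g⁻¹`. Then `⁅φ, t⁆` costs two conjugates and `⁅a, b⁆`
costs four (`exists_commutator_eq_four`), whence 6 and 2. For `F_τ`, take `Γ` to be the elements
supported in a compact part of `(0, 1)`. Powers of two-slope bumps with endpoints in the dense ring
`ℤ[τ]` give the stretching (`FTau.isProximalAction`). The slopes at `0` and `1` can be cancelled by
two commuting bumps modulo `Γ`, which yields `F_τ' = Γ'` (`FTau.commutator_eq`). -/

open Set Filter Topology
open scoped commutatorElement

/-! ### Uniform simplicity and perfectness from bounded proximal actions on a linear order. -/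

section Proximal

/-- Elements with complementary supports commute. -/
theorem commute_of_mem_fixingSubgroup {Γ X : Type*} [Group Γ] [MulAction Γ X] [FaithfulSMul Γ X]
    {S : Set X} {g h : Γ}
    (hg : g ∈ fixingSubgroup Γ Sᶜ) (hh : h ∈ fixingSubgroup Γ S) : Commute g h := by
  have key : ∀ {T : Set X} {k : Γ}, k ∈ fixingSubgroup Γ Tᶜ → ∀ x ∈ T, k • x ∈ T := by
    intro T k hk x hx
    by_contra hn
    rw [mem_fixingSubgroup_iff] at hk
    have h1 := hk _ hn
    exact hn ((MulAction.injective k h1).symm ▸ hx)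
  have hh' : h ∈ fixingSubgroup Γ Sᶜᶜ := by rwa [compl_compl]
  apply eq_of_smul_eq_smul (α := X)
  intro x
  rw [mul_smul, mul_smul]
  by_cases hx : x ∈ S
  · rw [(mem_fixingSubgroup_iff Γ).1 hh x hx, (mem_fixingSubgroup_iff Γ).1 hh _ (key hg x hx)]
  · rw [(mem_fixingSubgroup_iff Γ).1 hg x hx, (mem_fixingSubgroup_iff Γ).1 hg _ (key hh' x hx)]

variable {Γ X : Type*} [Group Γ] [LinearOrder X] [MulAction Γ X]

variable (Γ X) in
/-- The action is faithful, order preserving, bounded (every element is supported in a compact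
interval) and proximal. -/
structure IsProximalAction : Prop where
  faithful : FaithfulSMul Γ X
  strictMono (g : Γ) : StrictMono fun x : X => g • x
  bounded (g : Γ) : ∃ p q : X, p < q ∧ g ∈ fixingSubgroup Γ (Icc p q)ᶜ
  proximal (a b c d : X) : a < b → c < d → ∃ g : Γ, g • a < c ∧ d < g • b

theorem fixingSubgroup_compl_Icc_mono {p q p' q' : X} (hp : p' ≤ p) (hq : q ≤ q') :
    fixingSubgroup Γ (Icc p q)ᶜ ≤ fixingSubgroup Γ (Icc p' q')ᶜ :=
  fixingSubgroup_antitone Γ X (compl_subset_compl.2 (Icc_subset_Icc hp hq))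

namespace IsProximalAction

variable (H : IsProximalAction Γ X)
include H

theorem bounded_list (l : List Γ) (hl : l ≠ []) :
    ∃ p q : X, p < q ∧ ∀ g ∈ l, g ∈ fixingSubgroup Γ (Icc p q)ᶜ := by
  induction l with
  | nil => exact absurd rfl hl
  | cons g l ih =>
    obtain ⟨p, q, hpq, hg⟩ := H.bounded g
    by_cases hl' : l = []
    · subst hl'
      exact ⟨p, q, hpq, by simpa using hg⟩
    · obtain ⟨p', q', hpq', hl''⟩ := ih hl'
      refine ⟨min p p', max q q', (min_le_left _ _).trans_lt (hpq.trans_le (le_max_left _ _)), ?_⟩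
      intro h hh
      rcases List.mem_cons.1 hh with rfl | hh
      · exact fixingSubgroup_compl_Icc_mono (min_le_left _ _) (le_max_left _ _) hg
      · exact fixingSubgroup_compl_Icc_mono (min_le_right _ _) (le_max_right _ _) (hl'' h hh)

theorem exists_displacing {p q : X} (hpq : p < q) : ∃ c : Γ, q < c • p := by
  -- This only supplies a point `g • p` below `p`; the interval from `g • p` to `p` is then
  -- stretched so that its right end passes `q`.
  obtain ⟨g, hg, -⟩ := H.proximal p q p q hpq hpq
  obtain ⟨c, -, hc⟩ := H.proximal _ p p q hg hpq
  exact ⟨c, hc⟩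

theorem conj_mem_fixingSubgroup_Iic {p q : X} {c g : Γ} (hc : q < c • p)
    (hg : g ∈ fixingSubgroup Γ (Icc p q)ᶜ) : c * g * c⁻¹ ∈ fixingSubgroup Γ (Iic q) := by
  rw [mem_fixingSubgroup_iff] at hg ⊢
  intro x hx
  have : c⁻¹ • x ∉ Icc p q := fun h => by
    have := (H.strictMono c).monotone h.1
    simp only [smul_inv_smul] at this
    exact absurd (hc.trans_le this) (not_lt.2 hx)
  rw [mul_smul, mul_smul, hg _ this, smul_inv_smul]

theorem commute_of_Icc_of_Iic {p q : X} {g h : Γ} (hg : g ∈ fixingSubgroup Γ (Icc p q)ᶜ)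
    (hh : h ∈ fixingSubgroup Γ (Iic q)) : Commute g h :=
  have := H.faithful
  commute_of_mem_fixingSubgroup hg (fixingSubgroup_antitone Γ X Icc_subset_Iic_self hh)

/-- Displacing the supports of `a` and `b` replaces `b` by an element of the commutator subgroup. -/
theorem exists_commutator_eq_right (a b : Γ) : ∃ b' ∈ commutator Γ, ⁅a, b⁆ = ⁅a, b'⁆ := by
  obtain ⟨p, q, hpq, hl⟩ := H.bounded_list [a, b] (by simp)
  have ha := hl a (by simp)
  have hb := hl b (by simp)
  obtain ⟨c, hc⟩ := H.exists_displacing hpq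
  have h := H.conj_mem_fixingSubgroup_Iic hc (inv_mem hb)
  refine ⟨⁅b, c⁆, Subgroup.commutator_mem_commutator trivial trivial, ?_⟩
  have e : ⁅b, c⁆ = b * (c * b⁻¹ * c⁻¹) := by rw [commutatorElement_def]; group
  have h1 : Commute a (c * b⁻¹ * c⁻¹) := H.commute_of_Icc_of_Iic ha h
  rw [e]
  generalize c * b⁻¹ * c⁻¹ = k at h1
  simp only [commutatorElement_def, mul_inv_rev]
  calc a * b * a⁻¹ * b⁻¹ = a * b * (k * a⁻¹) * k⁻¹ * b⁻¹ := by
        rw [h1.inv_left.symm.eq]; group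
    _ = _ := by group

/-- Both entries are replaced in turn, the first one through `⁅a, b⁆⁻¹ = ⁅b, a⁆`. Hence `Γ'` is
perfect. -/
theorem exists_commutator_eq (a b : Γ) :
    ∃ a' ∈ commutator Γ, ∃ b' ∈ commutator Γ, ⁅a, b⁆ = ⁅a', b'⁆ := by
  obtain ⟨b', hb', e⟩ := H.exists_commutator_eq_right a b
  obtain ⟨a', ha', e'⟩ := H.exists_commutator_eq_right b' a
  refine ⟨a', ha', b', hb', ?_⟩
  rw [e, ← inv_inj, commutatorElement_inv, commutatorElement_inv, e']

theorem exists_list_commutators {f : Γ} (hf : f ∈ commutator Γ) :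
    ∃ l : List (Γ × Γ), (∀ x ∈ l, x.1 ∈ commutator Γ ∧ x.2 ∈ commutator Γ) ∧
      (l.map fun x => ⁅x.1, x.2⁆).prod = f := by
  rw [commutator_eq_closure] at hf
  rw [← Subgroup.mem_toSubmonoid, Subgroup.closure_toSubmonoid] at hf
  obtain ⟨l, hl, rfl⟩ := Submonoid.exists_list_of_mem_closure hf
  clear hf
  induction l with
  | nil => exact ⟨[], by simp, by simp⟩
  | cons c l ih =>
    obtain ⟨l', hl', e⟩ := ih fun x hx => hl x (List.mem_cons_of_mem _ hx)
    have : ∃ a b : Γ, ⁅a, b⁆ = c := by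
      rcases hl c List.mem_cons_self with ⟨a, b, h⟩ | ⟨a, b, h⟩
      · exact ⟨a, b, h⟩
      · exact ⟨b, a, by rw [← commutatorElement_inv, h, inv_inv]⟩
    obtain ⟨a, b, rfl⟩ := this
    obtain ⟨a', ha', b', hb', e'⟩ := H.exists_commutator_eq a b
    refine ⟨(a', b') :: l', ?_, by simp [e, e']⟩
    intro x hx
    rcases List.mem_cons.1 hx with rfl | hx
    · exact ⟨ha', hb'⟩
    · exact hl' x hx

/-- A product of commutators supported in an interval which `t` displaces is the product of a
commutator with `t` and one more commutator. -/
theorem exists_eq_commutator_mul_commutator {p q : X} (hpq : p < q) {t : Γ}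
    (ht : q < t • p) (D : Subgroup Γ) [D.Normal]
    (l : List (Γ × Γ)) (hD : ∀ x ∈ l, x.1 ∈ D ∧ x.2 ∈ D)
    (hl : ∀ x ∈ l, x.1 ∈ fixingSubgroup Γ (Icc p q)ᶜ ∧ x.2 ∈ fixingSubgroup Γ (Icc p q)ᶜ) :
    ∃ φ ∈ D, ∃ a ∈ D ⊓ fixingSubgroup Γ (Iic q), ∃ b ∈ D ⊓ fixingSubgroup Γ (Iic q),
      (l.map fun x => ⁅x.1, x.2⁆).prod = ⁅φ, t⁆ * ⁅a, b⁆ := by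
  induction l with
  | nil => exact ⟨1, one_mem _, 1, one_mem _, 1, one_mem _, by simp⟩
  | cons x l ih =>
    have hl' := fun y hy => hl y (List.mem_cons_of_mem x hy)
    have hD' := fun y hy => hD y (List.mem_cons_of_mem x hy)
    obtain ⟨φ, hφ, a, ha, b, hb, e⟩ := ih hD' hl'
    obtain ⟨a₁, b₁⟩ := x
    obtain ⟨ha₁, hb₁⟩ := hl (a₁, b₁) List.mem_cons_self
    obtain ⟨hDa₁, hDb₁⟩ := hD (a₁, b₁) List.mem_cons_self
    simp only at ha₁ hb₁ hDa₁ hDb₁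
    have mem_of : ∀ K : Subgroup Γ, (∀ x ∈ l, x.1 ∈ K ∧ x.2 ∈ K) →
        (l.map fun x => ⁅x.1, x.2⁆).prod ∈ K := by
      intro K hK
      apply list_prod_mem
      intro y hy
      obtain ⟨x, hx, rfl⟩ := List.mem_map.1 hy
      obtain ⟨h1, h2⟩ := hK x hx
      exact mul_mem (mul_mem (mul_mem h1 h2) (inv_mem h1)) (inv_mem h2)
    have hf := mem_of _ hl'
    have hfD := mem_of _ hD'
    simp only [List.map_cons, List.prod_cons]
    generalize (l.map fun x => ⁅x.1, x.2⁆).prod = f at e hf hfD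
    have hcD : ⁅a₁, b₁⁆ ∈ D :=
      mul_mem (mul_mem (mul_mem hDa₁ hDb₁) (inv_mem hDa₁)) (inv_mem hDb₁)
    -- From `q < t • p < t • q`, conjugation by `t` carries supports in `[p, q]` beyond `q` and
    -- keeps there those already beyond `q`.
    have hshift : ∀ k m : Γ, k ∈ fixingSubgroup Γ (Icc p q)ᶜ → m ∈ fixingSubgroup Γ (Iic q) →
        t * (k * m) * t⁻¹ ∈ fixingSubgroup Γ (Iic q) := by
      intro k m hk hm
      have h1 := H.conj_mem_fixingSubgroup_Iic ht hk
      have h2 : t * m * t⁻¹ ∈ fixingSubgroup Γ (Iic q) := by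
        rw [mem_fixingSubgroup_iff] at hm ⊢
        intro x hx
        have hq : ¬ q < t⁻¹ • x := fun h => by
          have h3 := H.strictMono t h
          simp only [smul_inv_smul] at h3
          have h4 : q < t • q := ht.trans (H.strictMono t hpq)
          exact absurd (h4.trans h3) (not_lt.2 hx)
        rw [mul_smul, mul_smul, hm _ (not_lt.1 hq), smul_inv_smul]
      have : t * (k * m) * t⁻¹ = (t * k * t⁻¹) * (t * m * t⁻¹) := by group
      rw [this]
      exact mul_mem h1 h2
    have hn : D.Normal := inferInstance
    -- Unrolled, with `c_i = ⁅a_i, b_i⁆` and tails `F_i = c_i ⋯ c_n`: `φ` is the product of the `t^i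
    -- F_{i+1} t^{-i}` for `0 ≤ i < n`, and `a`, `b` are the products of the `t^i a_i t^{-i}`, `t^i
    -- b_i t^{-i}` for `1 ≤ i ≤ n`. Then `⁅φ, t⁆` telescopes to `F_1` times the `t^i c_i⁻¹ t^{-i}`,
    -- which `⁅a, b⁆` cancels.
    refine ⟨⁅a₁, b₁⁆ * f * (t * φ * t⁻¹), mul_mem (mul_mem hcD hfD) (hn.conj_mem _ hφ t),
      t * (a₁ * a) * t⁻¹, ⟨hn.conj_mem _ (mul_mem hDa₁ ha.1) t, hshift _ _ ha₁ ha.2⟩,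
      t * (b₁ * b) * t⁻¹, ⟨hn.conj_mem _ (mul_mem hDb₁ hb.1) t, hshift _ _ hb₁ hb.2⟩, ?_⟩
    have c1 : Commute a₁ a := H.commute_of_Icc_of_Iic ha₁ ha.2
    have c2 : Commute a₁ b := H.commute_of_Icc_of_Iic ha₁ hb.2
    have c3 : Commute b₁ a := H.commute_of_Icc_of_Iic hb₁ ha.2
    have c4 : Commute b₁ b := H.commute_of_Icc_of_Iic hb₁ hb.2
    have c5 : Commute f ⁅a, b⁆ := H.commute_of_Icc_of_Iic hf
      (mul_mem (mul_mem (mul_mem ha.2 hb.2) (inv_mem ha.2)) (inv_mem hb.2))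
    have e1 : ⁅a₁ * a, b₁ * b⁆ = ⁅a₁, b₁⁆ * ⁅a, b⁆ := by
      simp only [commutatorElement_def, mul_inv_rev]
      calc a₁ * a * (b₁ * b) * (a⁻¹ * a₁⁻¹) * (b⁻¹ * b₁⁻¹)
          = a₁ * (a * b₁) * b * (a⁻¹ * a₁⁻¹) * (b⁻¹ * b₁⁻¹) := by group
        _ = a₁ * b₁ * (a * b * a⁻¹) * (a₁⁻¹ * b⁻¹) * b₁⁻¹ := by rw [← c3.eq]; group
        _ = a₁ * b₁ * (a * b * a⁻¹ * b⁻¹ * a₁⁻¹) * b₁⁻¹ := by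
          rw [c2.inv_left.inv_right.eq]; group
        _ = a₁ * b₁ * (a₁⁻¹ * (a * b * a⁻¹ * b⁻¹)) * b₁⁻¹ := by
          rw [(((c1.mul_right c2).mul_right c1.inv_right).mul_right c2.inv_right).inv_left.eq]
        _ = a₁ * b₁ * a₁⁻¹ * ((a * b * a⁻¹ * b⁻¹) * b₁⁻¹) := by group
        _ = a₁ * b₁ * a₁⁻¹ * (b₁⁻¹ * (a * b * a⁻¹ * b⁻¹)) := by
          rw [(((c3.mul_right c4).mul_right c3.inv_right).mul_right c4.inv_right).inv_left.eq]
        _ = _ := by group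
    have e2 : ⁅t * (a₁ * a) * t⁻¹, t * (b₁ * b) * t⁻¹⁆ = t * (⁅a₁, b₁⁆ * ⁅a, b⁆) * t⁻¹ := by
      rw [← e1]; simp only [commutatorElement_def]; group
    have e3 : φ * t * φ⁻¹ * t⁻¹ = f * ⁅a, b⁆⁻¹ := by
      rw [e, commutatorElement_def φ t]; group
    rw [e2]
    generalize ⁅a₁, b₁⁆ = c
    generalize ⁅a, b⁆ = k at c5 e3
    calc c * f = c * f * t * (f * k⁻¹ * f⁻¹ * k) * t⁻¹ := by
          rw [c5.inv_right.eq]; group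
      _ = c * f * t * (φ * t * φ⁻¹ * t⁻¹ * f⁻¹ * k) * t⁻¹ := by rw [e3]
      _ = _ := by rw [commutatorElement_def]; group


/-- Every element agrees on a given interval with an element of the commutator subgroup. -/
theorem exists_mem_commutator_eqOn (h : Γ) (p q : X) (hpq : p < q) :
    ∃ d ∈ commutator Γ, ∀ x ∈ Icc p q, d • x = h • x := by
  obtain ⟨r, s, hrs, hh⟩ := H.bounded h
  have hh' := fixingSubgroup_compl_Icc_mono (min_le_right p r) (le_max_right q s) hh
  have hlt : min p r < max q s := (min_le_left _ _).trans_lt (hpq.trans_le (le_max_left _ _))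
  obtain ⟨c, hc⟩ := H.exists_displacing hlt
  have hk := H.conj_mem_fixingSubgroup_Iic hc (inv_mem hh')
  -- `⁅h, c⁆` is `h` times a conjugate of `h⁻¹` whose support lies beyond the interval.
  refine ⟨⁅h, c⁆, Subgroup.commutator_mem_commutator trivial trivial, fun x hx => ?_⟩
  have e : ⁅h, c⁆ = h * (c * h⁻¹ * c⁻¹) := by rw [commutatorElement_def]; group
  rw [e, mul_smul, (mem_fixingSubgroup_iff Γ).1 hk x (hx.2.trans (le_max_left _ _))]

/-- Some conjugate of `g` or `g⁻¹` by an element of the commutator subgroup displaces a given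
interval. -/
theorem exists_conj_displacing {g : Γ} (hg : g ≠ 1) {p q : X} (hpq : p < q) :
    ∃ d ∈ commutator Γ, q < (d * g * d⁻¹) • p ∨ q < (d * g⁻¹ * d⁻¹) • p := by
  have := H.faithful
  -- Stretch `[x, k • x]` over `[p, q]` by some `d`: the conjugate of `k` by `d` sends `d • x < p`
  -- to `d • (k • x) > q`, hence `p` beyond `q`. Only two values of the stretching map matter, so it
  -- may be taken in `Γ'`.
  have key : ∀ (k : Γ) (x : X), x < k • x → ∃ d ∈ commutator Γ, q < (d * k * d⁻¹) • p := by
    intro k x hx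
    obtain ⟨h, h1, h2⟩ := H.proximal x (k • x) p q hx hpq
    obtain ⟨d, hd, he⟩ := H.exists_mem_commutator_eqOn h x (k • x) hx
    refine ⟨d, hd, ?_⟩
    rw [← he x ⟨le_rfl, hx.le⟩] at h1
    rw [← he (k • x) ⟨hx.le, le_rfl⟩] at h2
    have h3 := H.strictMono (d * k * d⁻¹) h1
    simp only [mul_smul, inv_smul_smul] at h3
    simpa only [mul_smul] using h2.trans h3
  obtain ⟨x, hx⟩ : ∃ x : X, g • x ≠ x := by
    by_contra hn
    push Not at hn
    exact hg (eq_of_smul_eq_smul (α := X) fun x => by rw [hn, one_smul])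
  rcases lt_or_gt_of_ne hx with h | h
  · have h' := H.strictMono g⁻¹ h
    simp only [inv_smul_smul] at h'
    obtain ⟨d, hd, hd'⟩ := key g⁻¹ x h'
    exact ⟨d, hd, Or.inr hd'⟩
  · obtain ⟨d, hd, hd'⟩ := key g x h
    exact ⟨d, hd, Or.inl hd'⟩

theorem exists_conj_displacing' {g : commutator Γ} (hg : g ≠ 1) {p q : X} (hpq : p < q) :
    ∃ t : commutator Γ, (IsConj g t ∨ IsConj g⁻¹ t) ∧ q < t • p := by
  obtain ⟨d, hd, h⟩ := H.exists_conj_displacing (g := (g : Γ)) (by simpa using hg) hpq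
  rcases h with h | h
  · exact ⟨⟨d, hd⟩ * g * ⟨d, hd⟩⁻¹, Or.inl (isConj_iff.2 ⟨_, rfl⟩), h⟩
  · exact ⟨⟨d, hd⟩ * g⁻¹ * ⟨d, hd⟩⁻¹, Or.inr (isConj_iff.2 ⟨_, rfl⟩), h⟩

theorem exists_eq_commutator_mul_commutator' (f : commutator Γ) {g : commutator Γ} (hg : g ≠ 1) :
    ∃ t φ a b : commutator Γ, (IsConj g t ∨ IsConj g⁻¹ t) ∧ f = ⁅φ, t⁆ * ⁅a, b⁆ := by
  obtain ⟨l, hl, hlf⟩ := H.exists_list_commutators f.2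
  -- The entry `1` covers the case of an empty `l`.
  obtain ⟨p, q, hpq, hs⟩ := H.bounded_list (1 :: (l.map Prod.fst ++ l.map Prod.snd)) (by simp)
  obtain ⟨t, ht, htp⟩ := H.exists_conj_displacing' hg hpq
  obtain ⟨φ, hφ, a, ha, b, hb, e⟩ := H.exists_eq_commutator_mul_commutator hpq (t := (t : Γ)) htp
    (commutator Γ) l hl fun x hx => ⟨hs _ (List.mem_cons_of_mem _ (List.mem_append_left _
      (List.mem_map_of_mem hx))), hs _ (List.mem_cons_of_mem _ (List.mem_append_right _
      (List.mem_map_of_mem hx)))⟩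
  exact ⟨t, ⟨φ, hφ⟩, ⟨a, ha.1⟩, ⟨b, hb.1⟩, ht, Subtype.ext (hlf.symm.trans e)⟩

/-- A commutator is the product of four conjugates of `t` and `t⁻¹` if `t` displaces supports. -/
theorem exists_commutator_eq_four (a b : commutator Γ) {g : commutator Γ} (hg : g ≠ 1) :
    ∃ t : commutator Γ, (IsConj g t ∨ IsConj g⁻¹ t) ∧
      ⁅a, b⁆ = (a * t * a⁻¹) * t⁻¹ * (b * t * b⁻¹) * (b * a * t⁻¹ * (b * a)⁻¹) := by
  obtain ⟨p, q, hpq, hs⟩ := H.bounded_list [(a : Γ), (b : Γ)] (by simp)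
  obtain ⟨t, ht, htp⟩ := H.exists_conj_displacing' hg hpq
  refine ⟨t, ht, ?_⟩
  -- Since `t * a⁻¹ * t⁻¹` commutes with `b`, one has `⁅⁅a, t⁆, b⁆ = ⁅a, b⁆`; the left side expands
  -- into the four conjugates.
  have h := H.conj_mem_fixingSubgroup_Iic (c := (t : Γ)) htp (inv_mem (hs a (by simp)))
  have hc' := H.commute_of_Icc_of_Iic (hs b (by simp)) h
  have hc : b * (t * a⁻¹ * t⁻¹) = (t * a⁻¹ * t⁻¹) * b := Subtype.ext hc'.eq
  symm
  calc (a * t * a⁻¹) * t⁻¹ * (b * t * b⁻¹) * (b * a * t⁻¹ * (b * a)⁻¹)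
      = a * ((t * a⁻¹ * t⁻¹) * b) * (t * a * t⁻¹) * a⁻¹ * b⁻¹ := by group
    _ = a * (b * (t * a⁻¹ * t⁻¹)) * (t * a * t⁻¹) * a⁻¹ * b⁻¹ := by rw [hc]
    _ = ⁅a, b⁆ := by rw [commutatorElement_def]; group

theorem isUniformlyPerfect : IsUniformlyPerfect 2 (commutator Γ) := by
  intro f hf
  obtain ⟨t, φ, a, b, -, e⟩ := H.exists_eq_commutator_mul_commutator' f hf
  refine ⟨[⁅φ, t⁆, ⁅a, b⁆], by simp, ?_, by simp [e]⟩
  intro h hh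
  simp only [List.mem_cons, List.not_mem_nil, or_false] at hh
  rcases hh with rfl | rfl
  · exact ⟨φ, t, rfl⟩
  · exact ⟨a, b, rfl⟩

theorem isUniformlySimple : IsUniformlySimple 6 (commutator Γ) := by
  intro f g _ hg
  obtain ⟨t, φ, a, b, ht, e⟩ := H.exists_eq_commutator_mul_commutator' f hg
  obtain ⟨s, hs, e'⟩ := H.exists_commutator_eq_four a b hg
  have conj : ∀ k t : commutator Γ, IsConj g t ∨ IsConj g⁻¹ t →
      IsConj g (k * t * k⁻¹) ∨ IsConj g⁻¹ (k * t * k⁻¹) := fun k t ht =>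
    ht.imp (fun h => h.trans (isConj_iff.2 ⟨k, rfl⟩)) fun h => h.trans (isConj_iff.2 ⟨k, rfl⟩)
  have inv : ∀ t : commutator Γ, IsConj g t ∨ IsConj g⁻¹ t → IsConj g t⁻¹ ∨ IsConj g⁻¹ t⁻¹ := by
    have aux : ∀ x y : commutator Γ, IsConj x y → IsConj x⁻¹ y⁻¹ := by
      intro x y h
      obtain ⟨c, rfl⟩ := isConj_iff.1 h
      exact isConj_iff.2 ⟨c, by group⟩
    rintro t (h | h)
    · exact Or.inr (aux _ _ h)
    · exact Or.inl (by simpa using aux _ _ h)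
  refine ⟨[φ * t * φ⁻¹, t⁻¹, a * s * a⁻¹, s⁻¹, b * s * b⁻¹, b * a * s⁻¹ * (b * a)⁻¹], by simp, ?_,
    ?_⟩
  · intro h hh
    simp only [List.mem_cons, List.not_mem_nil, or_false] at hh
    rcases hh with rfl | rfl | rfl | rfl | rfl | rfl
    exacts [conj _ _ ht, inv _ ht, conj _ _ hs, inv _ hs, conj _ _ hs, conj _ _ (inv _ hs)]
  · rw [e, e', commutatorElement_def]
    simp [mul_assoc]

end IsProximalAction

theorem IsUniformlySimple.of_mulEquiv {n : ℕ} {G G' : Type*} [Group G] [Group G'] (e : G ≃* G')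
    (h : IsUniformlySimple n G) : IsUniformlySimple n G' := by
  intro f g hf hg
  obtain ⟨l, hl, hc, hp⟩ := h (e.symm f) (e.symm g) (by simpa using hf) (by simpa using hg)
  refine ⟨l.map e, by simpa using hl, ?_, by rw [← map_list_prod, hp, e.apply_symm_apply]⟩
  intro x hx
  obtain ⟨y, hy, rfl⟩ := List.mem_map.1 hx
  refine (hc y hy).imp (fun h => ?_) fun h => ?_
  · simpa using e.toMonoidHom.map_isConj h
  · simpa using e.toMonoidHom.map_isConj h

theorem IsUniformlyPerfect.of_mulEquiv {n : ℕ} {G G' : Type*} [Group G] [Group G'] (e : G ≃* G')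
    (h : IsUniformlyPerfect n G) : IsUniformlyPerfect n G' := by
  intro f hf
  obtain ⟨l, hl, hc, hp⟩ := h (e.symm f) (by simpa using hf)
  refine ⟨l.map e, by simpa using hl, ?_, by rw [← map_list_prod, hp, e.apply_symm_apply]⟩
  intro x hx
  obtain ⟨y, hy, rfl⟩ := List.mem_map.1 hx
  obtain ⟨a, b, rfl⟩ := hc y hy
  exact ⟨e a, e b, by simp⟩

end Proximal

/-! ### Density of `ℤ[τ]` and the basic bump maps. -/

theorem tau_lt_one : tau < 1 := by
  have := tau_mul
  have := tau_pos
  nlinarith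

theorem tau_inv : tau⁻¹ = tau + 1 := inv_eq_of_mul_eq_one_right tau_mul

/-- `ℤ[τ]` is dense in `ℝ`. -/
theorem exists_mem_ZTau_between {x y : ℝ} (h : x < y) : ∃ z ∈ ZTau, x < z ∧ z < y := by
  have hd : Dense (ZTau.toSubring.toAddSubgroup : Set ℝ) := by
    apply AddSubgroup.dense_of_not_isolated_zero
    intro ε hε
    obtain ⟨n, hn⟩ := exists_pow_lt_of_lt_one hε tau_lt_one
    exact ⟨tau ^ n, ZTau.pow_mem tau_mem n, pow_pos tau_pos n, hn⟩
  obtain ⟨z, hz, h1, h2⟩ := hd.exists_between h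
  exact ⟨z, hz, h1, h2⟩

theorem exists_mem_ZTau_between' {x y : unitInterval} (h : x < y) :
    ∃ z : unitInterval, (z : ℝ) ∈ ZTau ∧ x < z ∧ z < y := by
  obtain ⟨z, hz, h1, h2⟩ := exists_mem_ZTau_between (show (x : ℝ) < y from h)
  exact ⟨⟨z, x.2.1.trans h1.le, h2.le.trans y.2.2⟩, hz, h1, h2⟩

section Bump

/-- The map which is the identity outside `[u, v]`, is affine of slope `τ` and then of slope `τ⁻¹`
on `[u, v]`. -/
noncomputable def bumpFun (u v x : ℝ) : ℝ :=
  min x (max (u + tau * (x - u)) (v + tau⁻¹ * (x - v)))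

theorem bumpFun_strictMono (u v : ℝ) : StrictMono (bumpFun u v) := by
  have h1 := tau_pos
  have h2 := inv_pos.2 tau_pos
  intro x y h
  have h3 := mul_lt_mul_of_pos_left (sub_lt_sub_right h u) h1
  have h4 := mul_lt_mul_of_pos_left (sub_lt_sub_right h v) h2
  exact min_lt_min h (max_lt_max (by linarith) (by linarith))

theorem bumpFun_continuous (u v : ℝ) : Continuous (bumpFun u v) := by
  unfold bumpFun; fun_prop

theorem bumpFun_of_le_left {u v x : ℝ} (h : x ≤ u) : bumpFun u v x = x := by
  apply min_eq_left
  apply le_max_of_le_left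
  nlinarith [tau_lt_one]

theorem bumpFun_of_right_le {u v x : ℝ} (h : v ≤ x) : bumpFun u v x = x := by
  apply min_eq_left
  apply le_max_of_le_right
  rw [tau_inv]
  nlinarith [tau_pos]

/-- The two affine pieces cross at `u + τ(v - u)`: there they take the values `u + τ²(v - u)` and `v
- τ(v - u)`, equal because `τ² + τ = 1`. -/
theorem bumpFun_of_mem_left {u v x : ℝ} (h : u ≤ x) (h' : x ≤ u + tau * (v - u)) :
    bumpFun u v x = u + tau * (x - u) := by
  have h1 := tau_pos
  have h2 := tau_lt_one
  have h3 := tau_mul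
  have : v + tau⁻¹ * (x - v) ≤ u + tau * (x - u) := by
    rw [tau_inv]
    have : tau * (tau * (v - u)) = (v - u) - tau * (v - u) := by linear_combination (v - u) * h3
    nlinarith
  rw [bumpFun, max_eq_left this, min_eq_right]
  nlinarith

theorem bumpFun_of_mem_right {u v x : ℝ} (h : x ≤ v) (h' : u + tau * (v - u) ≤ x) :
    bumpFun u v x = v + tau⁻¹ * (x - v) := by
  have h1 := tau_pos
  have h2 := tau_lt_one
  have h3 := tau_mul
  have : u + tau * (x - u) ≤ v + tau⁻¹ * (x - v) := by
    rw [tau_inv]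
    have : tau * (tau * (v - u)) = (v - u) - tau * (v - u) := by linear_combination (v - u) * h3
    nlinarith
  rw [bumpFun, max_eq_right this, min_eq_right]
  rw [tau_inv]
  nlinarith

theorem bumpFun_lt {u v x : ℝ} (h : u < x) (h' : x < v) : bumpFun u v x < x := by
  apply min_lt_of_right_lt
  apply max_lt
  · nlinarith [tau_lt_one]
  · rw [tau_inv]
    nlinarith [tau_pos]

theorem bumpFun_mem (u v x : unitInterval) : bumpFun u v x ∈ Icc (0 : ℝ) 1 := by
  refine ⟨le_min x.2.1 (le_max_of_le_left ?_), (min_le_left _ _).trans x.2.2⟩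
  have := mul_nonneg u.2.1 (sub_nonneg.2 tau_lt_one.le)
  have := mul_nonneg tau_pos.le x.2.1
  linarith

/-- `bumpFun` as a homeomorphism of `[0, 1]`. -/
noncomputable def bumpHomeo (u v : unitInterval) : unitInterval ≃ₜ unitInterval :=
  (StrictMono.orderIsoOfSurjective (fun x : unitInterval => ⟨bumpFun u v x, bumpFun_mem u v x⟩)
    (fun _ _ h => bumpFun_strictMono u v h) (fun c => by
      apply mem_range_of_exists_le_of_exists_ge
        (f := fun x : unitInterval => (⟨bumpFun u v x, bumpFun_mem u v x⟩ : unitInterval))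
      · exact ((bumpFun_continuous u v).comp continuous_subtype_val).subtype_mk _
      · exact ⟨0, by rw [Subtype.mk_le_mk]; exact (bumpFun_of_le_left u.2.1).trans_le c.2.1⟩
      · exact ⟨1, by rw [Subtype.mk_le_mk]; exact c.2.2.trans_eq (bumpFun_of_right_le v.2.2).symm⟩)).toHomeomorph

theorem coe_bumpHomeo (u v x : unitInterval) : (bumpHomeo u v x : ℝ) = bumpFun u v x := rfl

theorem bumpHomeo_mem {u v : unitInterval} (huv : u ≤ v) (hu : (u : ℝ) ∈ ZTau)
    (hv : (v : ℝ) ∈ ZTau) : bumpHomeo u v ∈ FTau := by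
  classical
  refine ⟨fun _ _ h => bumpFun_strictMono u v h, ?_⟩
  have h1 := tau_pos
  have h2 := tau_lt_one
  have huv' : (u : ℝ) ≤ v := huv
  have hw : (u : ℝ) + tau * (v - u) ∈ Icc (0 : ℝ) 1 := by
    have := u.2.1
    have := v.2.2
    constructor <;> nlinarith
  refine ⟨{u, ⟨_, hw⟩, v}, ?_, ?_⟩
  · intro s hs
    simp only [Finset.mem_insert, Finset.mem_singleton] at hs
    rcases hs with rfl | rfl | rfl
    · exact hu
    · exact ZTau.add_mem hu (ZTau.mul_mem tau_mem (ZTau.sub_mem hv hu))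
    · exact hv
  · intro a b hab hs
    have au := hs u (by simp)
    have aw := hs ⟨_, hw⟩ (by simp)
    have av := hs v (by simp)
    simp only [not_and_or, not_lt] at au aw av
    simp only [coe_bumpHomeo]
    rcases au with au | au
    swap
    · refine ⟨0, 0, fun x hx => ?_⟩
      rw [bumpFun_of_le_left (show (x : ℝ) ≤ u from hx.2.trans au)]
      simp
    rcases av with av | av
    · refine ⟨0, 0, fun x hx => ?_⟩
      rw [bumpFun_of_right_le (show (v : ℝ) ≤ x from av.trans hx.1)]
      simp
    rcases aw with aw | aw
    · refine ⟨-1, v - tau⁻¹ * v, fun x hx => ?_⟩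
      rw [bumpFun_of_mem_right (show (x : ℝ) ≤ v from hx.2.trans av)
        (show _ ≤ (x : ℝ) from le_trans (show _ ≤ (a : ℝ) from aw) hx.1), zpow_neg_one]
      ring
    · refine ⟨1, u - tau * u, fun x hx => ?_⟩
      rw [bumpFun_of_mem_left (show (u : ℝ) ≤ x from au.trans hx.1)
        (show (x : ℝ) ≤ _ from le_trans hx.2 (show (b : ℝ) ≤ _ from aw)), zpow_one]
      ring

end Bump

/-! ### The compactly supported subgroup and its proximal action on `(0, 1)`. -/

namespace FTau

theorem apply_zero (g : FTau) : (g : unitInterval ≃ₜ unitInterval) 0 = 0 :=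
  unitInterval_map_zero g.2.1

theorem apply_one (g : FTau) : (g : unitInterval ≃ₜ unitInterval) 1 = 1 := by
  apply le_antisymm unitInterval.le_one'
  have := g.2.1.monotone (unitInterval.le_one' (t := (g : unitInterval ≃ₜ unitInterval).symm 1))
  simpa using this

noncomputable instance : MulAction FTau unitInterval where
  smul g x := (g : unitInterval ≃ₜ unitInterval) x
  one_smul _ := rfl
  mul_smul _ _ _ := rfl

theorem smul_def (g : FTau) (x : unitInterval) : g • x = (g : unitInterval ≃ₜ unitInterval) x := rfl

theorem smul_strictMono (g : FTau) : StrictMono fun x : unitInterval => g • x := g.2.1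

theorem smul_zero_eq (g : FTau) : g • (0 : unitInterval) = 0 := apply_zero g

theorem smul_one_eq (g : FTau) : g • (1 : unitInterval) = 1 := apply_one g

theorem continuous_smul_left (g : FTau) : Continuous fun x : unitInterval => g • x :=
  (g : unitInterval ≃ₜ unitInterval).continuous

instance : FaithfulSMul FTau unitInterval :=
  ⟨fun h => Subtype.ext (Homeomorph.ext h)⟩

theorem smul_mem_Ioo (g : FTau) {x : unitInterval} (hx : x ∈ Ioo (0 : unitInterval) 1) :
    g • x ∈ Ioo (0 : unitInterval) 1 := by
  have h0 := smul_strictMono g hx.1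
  have h1 := smul_strictMono g hx.2
  simp only [smul_zero_eq, smul_one_eq] at h0 h1
  exact ⟨h0, h1⟩

noncomputable instance : MulAction FTau (Ioo (0 : unitInterval) 1) where
  smul g x := ⟨g • (x : unitInterval), smul_mem_Ioo g x.2⟩
  one_smul _ := rfl
  mul_smul _ _ _ := rfl

/-- The subgroup of elements with support in a compact subinterval of `(0, 1)`. -/
def compactlySupported : Subgroup FTau where
  carrier := {g | ∃ p q : unitInterval, 0 < p ∧ p < q ∧ q < 1 ∧
    g ∈ fixingSubgroup FTau (Icc p q)ᶜ}
  one_mem' := by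
    obtain ⟨p, hp, hp'⟩ := exists_between (zero_lt_one (α := unitInterval))
    obtain ⟨q, hq, hq'⟩ := exists_between hp'
    exact ⟨p, q, hp, hq, hq', one_mem _⟩
  mul_mem' := by
    rintro g h ⟨p, q, h1, h2, h3, h4⟩ ⟨p', q', h1', h2', h3', h4'⟩
    exact ⟨min p p', max q q', lt_min h1 h1', (min_le_left _ _).trans_lt
      (h2.trans_le (le_max_left _ _)), max_lt h3 h3', mul_mem
      (fixingSubgroup_compl_Icc_mono (min_le_left _ _) (le_max_left _ _) h4)
      (fixingSubgroup_compl_Icc_mono (min_le_right _ _) (le_max_right _ _) h4')⟩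
  inv_mem' := by
    rintro g ⟨p, q, h1, h2, h3, h4⟩
    exact ⟨p, q, h1, h2, h3, inv_mem h4⟩

theorem conj_mem_fixingSubgroup (g : FTau) {h : FTau} {p q : unitInterval}
    (hh : h ∈ fixingSubgroup FTau (Icc p q)ᶜ) :
    g * h * g⁻¹ ∈ fixingSubgroup FTau (Icc (g • p) (g • q))ᶜ := by
  rw [mem_fixingSubgroup_iff] at hh ⊢
  intro x hx
  have : g⁻¹ • x ∈ (Icc p q)ᶜ := fun hn => hx (by
    have h1 := (smul_strictMono g).monotone hn.1
    have h2 := (smul_strictMono g).monotone hn.2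
    simp only [smul_inv_smul] at h1 h2
    exact ⟨h1, h2⟩)
  rw [mul_smul, mul_smul, hh _ this, smul_inv_smul]

instance : compactlySupported.Normal := by
  refine ⟨?_⟩
  rintro h ⟨p, q, h1, h2, h3, h4⟩ g
  have hp := smul_mem_Ioo g ⟨h1, h2.trans h3⟩
  have hq := smul_mem_Ioo g ⟨h1.trans h2, h3⟩
  exact ⟨g • p, g • q, hp.1, smul_strictMono g h2, hq.2, conj_mem_fixingSubgroup g h4⟩

/-- The bump on `[u, v]` as an element of `F_τ`. -/
noncomputable def bump (u v : unitInterval) (huv : u ≤ v) (hu : (u : ℝ) ∈ ZTau)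
    (hv : (v : ℝ) ∈ ZTau) : FTau := ⟨bumpHomeo u v, bumpHomeo_mem huv hu hv⟩

section

variable {u v : unitInterval} (huv : u ≤ v) (hu : (u : ℝ) ∈ ZTau) (hv : (v : ℝ) ∈ ZTau)

theorem bump_mem_fixingSubgroup : bump u v huv hu hv ∈ fixingSubgroup FTau (Icc u v)ᶜ := by
  rw [mem_fixingSubgroup_iff]
  intro x hx
  apply Subtype.ext
  rcases not_and_or.1 hx with h | h
  · exact bumpFun_of_le_left (not_le.1 h).le
  · exact bumpFun_of_right_le (not_le.1 h).le

theorem bump_smul_of_le {x : unitInterval} (hx : x ≤ u) : bump u v huv hu hv • x = x :=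
  Subtype.ext (bumpFun_of_le_left hx)

theorem bump_smul_of_ge {x : unitInterval} (hx : v ≤ x) : bump u v huv hu hv • x = x :=
  Subtype.ext (bumpFun_of_right_le hx)

/-- Otherwise the decreasing orbit of `a` would converge to a fixed point in `[c, a]`, but the bump
has none strictly between `u` and `v`. -/
theorem exists_bump_pow_smul_lt {a c : unitInterval} (hc : u < c) (ha : a < v) :
    ∃ n : ℕ, bump u v huv hu hv ^ n • a < c := by
  by_contra! hn
  set g := bump u v huv hu hv
  have hle : ∀ x : unitInterval, g • x ≤ x := fun x => min_le_left (x : ℝ) _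
  have hanti : Antitone fun n : ℕ => g ^ n • a := by
    refine antitone_nat_of_succ_le fun n => ?_
    rw [pow_succ', mul_smul]
    exact hle _
  have hlim := tendsto_atTop_iInf hanti
  have hlim' := ((continuous_smul_left g).tendsto _).comp hlim
  have hfix := tendsto_nhds_unique hlim' (by
    have := (tendsto_add_atTop_iff_nat 1).2 hlim
    simpa only [Function.comp_def, pow_succ', mul_smul] using this)
  have h1 : c ≤ ⨅ n : ℕ, g ^ n • a := le_iInf hn
  have h2 : ⨅ n : ℕ, g ^ n • a ≤ a := by simpa using iInf_le (fun n : ℕ => g ^ n • a) 0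
  refine absurd hfix (ne_of_lt ?_)
  exact bumpFun_lt (hc.trans_le h1) (h2.trans_lt ha)

end

theorem isProximalAction : IsProximalAction compactlySupported (Ioo (0 : unitInterval) 1) where
  faithful := by
    refine ⟨fun {g h} hgh => Subtype.ext (eq_of_smul_eq_smul (α := unitInterval) fun x => ?_)⟩
    rcases eq_or_lt_of_le (unitInterval.nonneg' (t := x)) with rfl | h0
    · rw [smul_zero_eq, smul_zero_eq]
    rcases eq_or_lt_of_le (unitInterval.le_one' (t := x)) with rfl | h1
    · rw [smul_one_eq, smul_one_eq]
    exact congrArg Subtype.val (hgh ⟨x, h0, h1⟩)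
  strictMono g _ _ h := smul_strictMono (g : FTau) h
  bounded := by
    rintro ⟨g, p, q, h1, h2, h3, h4⟩
    refine ⟨⟨p, h1, h2.trans h3⟩, ⟨q, h1.trans h2, h3⟩, h2, ?_⟩
    rw [mem_fixingSubgroup_iff] at h4 ⊢
    exact fun x hx => Subtype.ext (h4 x hx)
  proximal := by
    rintro ⟨a, ha⟩ ⟨b, hb⟩ ⟨c, hc⟩ ⟨d, hd⟩ hab hcd
    have hab' : a < b := hab
    -- With `v` between `a` and `b`, the two ends move independently: a power of the bump on `[u,
    -- v]` pushes `a` below `c` and fixes `b`, and an inverse power of the bump on `[v, v']` pushes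
    -- `b` above `d` and fixes everything up to `v`.
    obtain ⟨u, hu, hu0, hu1⟩ := exists_mem_ZTau_between' (lt_min ha.1 hc.1)
    obtain ⟨v, hv, hv0, hv1⟩ := exists_mem_ZTau_between' hab'
    have huv := (hu1.trans_le (min_le_left _ _)).trans hv0
    obtain ⟨n, hn⟩ := exists_bump_pow_smul_lt huv.le hu hv (hu1.trans_le (min_le_right _ _)) hv0
    obtain ⟨v', hv', hv0', hv1'⟩ := exists_mem_ZTau_between' (max_lt hb.2 hd.2)
    have hvv' := hv1.trans ((le_max_left _ _).trans_lt hv0')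
    obtain ⟨m, hm⟩ := exists_bump_pow_smul_lt hvv'.le hv hv' hv1 hv0'
    have hg : bump u v huv.le hu hv ∈ compactlySupported :=
      ⟨u, v, hu0, huv, hv1.trans hb.2, bump_mem_fixingSubgroup _ _ _⟩
    have hk : bump v v' hvv'.le hv hv' ∈ compactlySupported :=
      ⟨v, v', ha.1.trans hv0, hvv', hv1', bump_mem_fixingSubgroup _ _ _⟩
    have fixK : ∀ x ≤ v, (bump v v' hvv'.le hv hv' ^ m)⁻¹ • x = x := fun x hx => by
      have : bump v v' hvv'.le hv hv' ∈ fixingSubgroup FTau (Iic v) :=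
        (mem_fixingSubgroup_iff _).2 fun x hx => bump_smul_of_le _ _ _ hx
      exact (mem_fixingSubgroup_iff _).1 (inv_mem (pow_mem this m)) x hx
    have fixG : ∀ x, v ≤ x → bump u v huv.le hu hv ^ n • x = x := fun x hx => by
      have : bump u v huv.le hu hv ∈ fixingSubgroup FTau (Ici v) :=
        (mem_fixingSubgroup_iff _).2 fun x hx => bump_smul_of_ge _ _ _ hx
      exact (mem_fixingSubgroup_iff _).1 (pow_mem this n) x hx
    refine ⟨(⟨_, hk⟩ ^ m)⁻¹ * ⟨_, hg⟩ ^ n, ?_, ?_⟩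
    · change ((bump v v' hvv'.le hv hv' ^ m)⁻¹ * bump u v huv.le hu hv ^ n) • a < c
      have h1 : bump u v huv.le hu hv ^ n • a ≤ v := by
        have := (smul_strictMono (bump u v huv.le hu hv ^ n)).monotone hv0.le
        exact this.trans_eq (fixG v le_rfl)
      rw [mul_smul, fixK _ h1]
      exact hn
    · change d < ((bump v v' hvv'.le hv hv' ^ m)⁻¹ * bump u v huv.le hu hv ^ n) • b
      rw [mul_smul, fixG b hv1.le]
      have := smul_strictMono (bump v v' hvv'.le hv hv' ^ m)⁻¹ hm
      simp only [inv_smul_smul] at this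
      exact (le_max_right b d).trans_lt this


/-! ### Germs at the endpoints. -/

/-- Near its fixed point `e`, the element `g` has slope `τ ^ k`. -/
def HasSlopeAt (e : unitInterval) (g : FTau) (k : ℤ) : Prop :=
  g • e = e ∧ ∀ᶠ x in 𝓝 e, ((g • x : unitInterval) : ℝ) - e = tau ^ k * ((x : ℝ) - e)

namespace HasSlopeAt

variable {e : unitInterval} {g h : FTau} {k l : ℤ}

theorem of_fixing (he : g • e = e) (h : ∀ᶠ x in 𝓝 e, g • x = x) : HasSlopeAt e g 0 :=
  ⟨he, h.mono fun x hx => by rw [hx, zpow_zero, one_mul]⟩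

theorem one : HasSlopeAt e 1 0 :=
  of_fixing (one_smul _ _) (Eventually.of_forall fun _ => one_smul _ _)

theorem mul (hg : HasSlopeAt e g k) (hh : HasSlopeAt e h l) : HasSlopeAt e (g * h) (k + l) := by
  refine ⟨by rw [mul_smul, hh.1, hg.1], ?_⟩
  have ht : Tendsto (fun x : unitInterval => h • x) (𝓝 e) (𝓝 e) := by
    have := (continuous_smul_left h).tendsto e
    rwa [hh.1] at this
  filter_upwards [hh.2, ht.eventually hg.2] with x h1 h2
  rw [mul_smul, h2, h1, zpow_add₀ tau_pos.ne', mul_assoc]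

theorem inv (hg : HasSlopeAt e g k) : HasSlopeAt e g⁻¹ (-k) := by
  have he : g⁻¹ • e = e := by rw [inv_smul_eq_iff, hg.1]
  refine ⟨he, ?_⟩
  have ht : Tendsto (fun x : unitInterval => g⁻¹ • x) (𝓝 e) (𝓝 e) := by
    have := (continuous_smul_left g⁻¹).tendsto e
    rwa [he] at this
  filter_upwards [ht.eventually hg.2] with x h1
  rw [smul_inv_smul] at h1
  rw [h1, ← mul_assoc, ← zpow_add₀ tau_pos.ne', neg_add_cancel, zpow_zero, one_mul]

theorem pow (hg : HasSlopeAt e g k) (n : ℕ) : HasSlopeAt e (g ^ n) (n * k) := by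
  induction n with
  | zero => simpa using one
  | succ n ih =>
    rw [pow_succ]
    convert ih.mul hg using 1
    push_cast
    ring

theorem zpow (hg : HasSlopeAt e g k) (n : ℤ) : HasSlopeAt e (g ^ n) (n * k) := by
  obtain ⟨m, rfl | rfl⟩ := n.eq_nat_or_neg
  · simpa using hg.pow m
  · simpa using (hg.pow m).inv

theorem eventually_fixing (hg : HasSlopeAt e g 0) : ∀ᶠ x in 𝓝 e, g • x = x :=
  hg.2.mono fun x hx => Subtype.ext (by simpa using hx)

end HasSlopeAt

theorem exists_hasSlopeAt (g : FTau) {e : unitInterval} (he : e = 0 ∨ e = 1) :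
    ∃ k, HasSlopeAt e g k := by
  have hge : g • e = e := by
    rcases he with rfl | rfl
    exacts [smul_zero_eq g, smul_one_eq g]
  obtain ⟨S, -, hS⟩ := g.2.2
  obtain ⟨a, b, hab, hea, hn, hs⟩ : ∃ a b : unitInterval, a < b ∧ e ∈ Icc a b ∧ Icc a b ∈ 𝓝 e ∧
      ∀ s ∈ S, ¬(a < s ∧ s < b) := by
    rcases he with rfl | rfl
    · have h : ∀ᶠ b in 𝓝[>] (0 : unitInterval), ∀ s ∈ S, ¬(0 < s ∧ s < b) := by
        rw [eventually_all_finset]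
        intro s _
        by_cases h0 : 0 < s
        · filter_upwards [nhdsWithin_le_nhds (Iio_mem_nhds h0)] with b hb hsb
          exact absurd (hb.trans hsb.2) (lt_irrefl _)
        · exact Eventually.of_forall fun b hb => h0 hb.1
      have : (𝓝[>] (0 : unitInterval)).NeBot := nhdsGT_neBot_of_exists_gt ⟨1, zero_lt_one⟩
      obtain ⟨b, hb, hb0⟩ := (h.and self_mem_nhdsWithin).exists
      refine ⟨0, b, hb0, ⟨le_rfl, le_of_lt hb0⟩, ?_, hb⟩
      filter_upwards [Iio_mem_nhds hb0] with x hx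
      exact ⟨unitInterval.nonneg', le_of_lt hx⟩
    · have h : ∀ᶠ a in 𝓝[<] (1 : unitInterval), ∀ s ∈ S, ¬(a < s ∧ s < 1) := by
        rw [eventually_all_finset]
        intro s _
        by_cases h0 : s < 1
        · filter_upwards [nhdsWithin_le_nhds (Ioi_mem_nhds h0)] with b hb hsb
          exact absurd (hb.trans hsb.1) (lt_irrefl _)
        · exact Eventually.of_forall fun b hb => h0 hb.2
      have : (𝓝[<] (1 : unitInterval)).NeBot := nhdsLT_neBot_of_exists_lt ⟨0, zero_lt_one⟩
      obtain ⟨a, ha, ha0⟩ := (h.and self_mem_nhdsWithin).exists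
      refine ⟨a, 1, ha0, ⟨le_of_lt ha0, le_rfl⟩, ?_, ha⟩
      filter_upwards [Ioi_mem_nhds ha0] with x hx
      exact ⟨le_of_lt hx, unitInterval.le_one'⟩
  obtain ⟨k, c, hk⟩ := hS a b hab hs
  refine ⟨k, hge, ?_⟩
  filter_upwards [hn] with x hx
  have h1 := hk x hx
  have h2 := hk e hea
  rw [← smul_def] at h1 h2
  rw [hge] at h2
  linear_combination h1 - h2

theorem mem_compactlySupported_of_hasSlopeAt {g : FTau} (h0 : HasSlopeAt 0 g 0)
    (h1 : HasSlopeAt 1 g 0) : g ∈ compactlySupported := by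
  have hb : ∃ p > (0 : unitInterval), ∀ x < p, g • x = x :=
    (nhds_bot_basis (α := unitInterval)).eventually_iff.1 h0.eventually_fixing
  have ht : ∃ q < (1 : unitInterval), ∀ x > q, g • x = x :=
    (nhds_top_basis (α := unitInterval)).eventually_iff.1 h1.eventually_fixing
  obtain ⟨p, hp, hp'⟩ := hb
  obtain ⟨q, hq, hq'⟩ := ht
  -- The points `r < s` force the two ends of the supporting interval into the right order.
  obtain ⟨r, hr, hr'⟩ := exists_between (zero_lt_one (α := unitInterval))
  obtain ⟨s, hs, hs'⟩ := exists_between hr'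
  refine ⟨min p r, max q s, lt_min hp hr, (min_le_right _ _).trans_lt
    (hs.trans_le (le_max_right _ _)), max_lt hq hs', ?_⟩
  rw [mem_fixingSubgroup_iff]
  intro x hx
  rcases not_and_or.1 hx with h | h
  · exact hp' x ((not_le.1 h).trans_le (min_le_left _ _))
  · exact hq' x ((le_max_left _ _).trans_lt (not_le.1 h))

theorem zero_mem : ((0 : unitInterval) : ℝ) ∈ ZTau := ZTau.zero_mem

theorem one_mem : ((1 : unitInterval) : ℝ) ∈ ZTau := ZTau.one_mem

theorem hasSlopeAt_bump_zero {v : unitInterval} (h0 : 0 ≤ v) (hv0 : 0 < v) (hv : (v : ℝ) ∈ ZTau) :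
    HasSlopeAt 0 (bump 0 v h0 zero_mem hv) 1 := by
  refine ⟨smul_zero_eq _, ?_⟩
  have hv0' : (0 : ℝ) < v := hv0
  have : ∀ᶠ x : unitInterval in 𝓝 0, (x : ℝ) < tau * v :=
    (continuous_subtype_val.tendsto (0 : unitInterval)).eventually
      (Iio_mem_nhds (mul_pos tau_pos hv0'))
  filter_upwards [this] with x hx
  have h : ((bump 0 v h0 zero_mem hv • x : unitInterval) : ℝ) = _ :=
    bumpFun_of_mem_left (u := ((0 : unitInterval) : ℝ)) (v := v) x.2.1 (by simpa using hx.le)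
  rw [h]
  simp

theorem hasSlopeAt_bump_one {u : unitInterval} (h1 : u ≤ 1) (hu1 : u < 1) (hu : (u : ℝ) ∈ ZTau) :
    HasSlopeAt 1 (bump u 1 h1 hu one_mem) (-1) := by
  refine ⟨smul_one_eq _, ?_⟩
  have hu1' : (u : ℝ) < 1 := hu1
  have : ∀ᶠ x : unitInterval in 𝓝 1, (u : ℝ) + tau * (1 - u) < x :=
    (continuous_subtype_val.tendsto (1 : unitInterval)).eventually
      (Ioi_mem_nhds (by
        have := mul_lt_mul_of_pos_right tau_lt_one (sub_pos.2 hu1')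
        simp only [Icc.coe_one]
        linarith))
  filter_upwards [this] with x hx
  have h : ((bump u 1 h1 hu one_mem • x : unitInterval) : ℝ) = _ :=
    bumpFun_of_mem_right (u := u) (v := ((1 : unitInterval) : ℝ)) x.2.2 (by simpa using hx.le)
  rw [h]
  simp

/-- Modulo `compactlySupported`, an element is a product of powers of bumps at `0` and at `1`. -/
theorem exists_zpow_mul_zpow_mul_mem {u v : unitInterval} (hv0 : 0 < v) (hv1 : v < 1) (hu0 : 0 < u)
    (hu1 : u < 1) (hu : (u : ℝ) ∈ ZTau) (hv : (v : ℝ) ∈ ZTau) (g : FTau) :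
    ∃ m n : ℤ, bump 0 v hv0.le zero_mem hv ^ m * bump u 1 hu1.le hu one_mem ^ n * g ∈
      compactlySupported := by
  obtain ⟨k, hk⟩ := exists_hasSlopeAt g (Or.inl rfl)
  obtain ⟨l, hl⟩ := exists_hasSlopeAt g (Or.inr rfl)
  have h00 := hasSlopeAt_bump_zero hv0.le hv0 hv
  have h11 := hasSlopeAt_bump_one hu1.le hu1 hu
  have h01 : HasSlopeAt 1 (bump 0 v hv0.le zero_mem hv) 0 := by
    refine .of_fixing (smul_one_eq _) ?_
    filter_upwards [Ioi_mem_nhds hv1] with x hx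
    exact bump_smul_of_ge _ _ _ (le_of_lt hx)
  have h10 : HasSlopeAt 0 (bump u 1 hu1.le hu one_mem) 0 := by
    refine .of_fixing (smul_zero_eq _) ?_
    filter_upwards [Iio_mem_nhds hu0] with x hx
    exact bump_smul_of_le _ _ _ (le_of_lt hx)
  -- The bump at `0` has exponent `1` there and the bump at `1` has exponent `-1` there, hence the
  -- opposite signs; each has exponent `0` at the other endpoint.
  refine ⟨-k, l, mem_compactlySupported_of_hasSlopeAt ?_ ?_⟩
  · simpa using ((h00.zpow (-k)).mul (h10.zpow l)).mul hk
  · simpa using ((h01.zpow (-k)).mul (h11.zpow l)).mul hl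

/-! ### The commutator subgroup of `F_τ` is that of the compactly supported subgroup. -/

/-- Conjugation by any element acts on compactly supported elements as conjugation by a compactly
supported one. -/
theorem commutator_mem_of_compactlySupported (g : FTau) {b : FTau} (hb : b ∈ compactlySupported) :
    ⁅g, b⁆ ∈ ⁅compactlySupported, compactlySupported⁆ := by
  obtain ⟨p, q, h1, h2, h3, h4⟩ := id hb
  have hp := smul_mem_Ioo g ⟨h1, h2.trans h3⟩
  have hq := smul_mem_Ioo g ⟨h1.trans h2, h3⟩
  have hc := conj_mem_fixingSubgroup g h4
  -- The bumps are placed off the support of `g * b * g⁻¹`, so the correction `z` that makes `z * g`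
  -- compactly supported commutes with this conjugate.
  obtain ⟨v, hv, hv0, hv1⟩ := exists_mem_ZTau_between' hp.1
  obtain ⟨u, hu, hu0, hu1⟩ := exists_mem_ZTau_between' hq.2
  obtain ⟨m, n, hmn⟩ := exists_zpow_mul_zpow_mul_mem hv0 (hv1.trans hp.2) (hq.1.trans hu0) hu1
    hu hv g
  have hx : bump 0 v hv0.le zero_mem hv ∈ fixingSubgroup FTau (Icc (g • p) (g • q)) :=
    (mem_fixingSubgroup_iff _).2 fun x hx => bump_smul_of_ge _ _ _ (hv1.le.trans hx.1)
  have hy : bump u 1 hu1.le hu one_mem ∈ fixingSubgroup FTau (Icc (g • p) (g • q)) :=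
    (mem_fixingSubgroup_iff _).2 fun x hx => bump_smul_of_le _ _ _ (hx.2.trans hu0.le)
  have hz := commute_of_mem_fixingSubgroup hc (mul_mem (zpow_mem hx m) (zpow_mem hy n))
  generalize bump 0 v hv0.le zero_mem hv ^ m * bump u 1 hu1.le hu one_mem ^ n = z at hmn hz
  have e : ⁅g, b⁆ = ⁅z * g, b⁆ := by
    calc ⁅g, b⁆ = g * b * g⁻¹ * b⁻¹ := commutatorElement_def _ _
      _ = (g * b * g⁻¹) * z * z⁻¹ * b⁻¹ := by group
      _ = z * (g * b * g⁻¹) * z⁻¹ * b⁻¹ := by rw [hz.eq]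
      _ = _ := by rw [commutatorElement_def]; group
  rw [e]
  exact Subgroup.commutator_mem_commutator hmn hb

/-- Modulo `N`, compactly supported elements are central, by `commutator_mem_of_compactlySupported`.
Together with two commuting bumps, one at each endpoint, they generate `F_τ`, so `F_τ ⧸ N` is
abelian. -/
theorem commutator_eq : commutator FTau = ⁅compactlySupported, compactlySupported⁆ := by
  refine le_antisymm ?_ (Subgroup.commutator_mono le_top le_top)
  rw [commutator_def, Subgroup.commutator_le]
  intro g _ h _
  obtain ⟨v, hv, hv0, hv1⟩ := exists_mem_ZTau_between' (zero_lt_one (α := unitInterval))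
  obtain ⟨u, hu, hu0, hu1⟩ := exists_mem_ZTau_between' hv1
  have hxy : Commute (bump 0 v hv0.le zero_mem hv) (bump u 1 hu1.le hu one_mem) :=
    commute_of_mem_fixingSubgroup (bump_mem_fixingSubgroup _ _ _) ((mem_fixingSubgroup_iff _).2
      fun x hx => bump_smul_of_le _ _ _ (hx.2.trans hu0.le))
  have key := exists_zpow_mul_zpow_mul_mem hv0 hv1 (hv0.trans hu0) hu1 hu hv
  generalize bump 0 v hv0.le zero_mem hv = x at hxy key
  generalize bump u 1 hu1.le hu one_mem = y at hxy key
  set N := ⁅compactlySupported, compactlySupported⁆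
  have comm_iff : ∀ a b : FTau, ⁅a, b⁆ ∈ N ↔ Commute (a : FTau ⧸ N) (b : FTau ⧸ N) := by
    intro a b
    rw [← QuotientGroup.eq_one_iff, ← commutatorElement_eq_one_iff_commute]
    rfl
  have hcen : ∀ a : FTau, ∀ b ∈ compactlySupported, Commute (a : FTau ⧸ N) (b : FTau ⧸ N) :=
    fun a b hb => (comm_iff a b).1 (commutator_mem_of_compactlySupported a hb)
  obtain ⟨m, n, hg⟩ := key g
  obtain ⟨m', n', hh⟩ := key h
  have hz : Commute (x ^ m * y ^ n) (x ^ m' * y ^ n') := by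
    have a1 := (Commute.refl x).zpow_zpow m m'
    have a2 := hxy.zpow_zpow m n'
    have a3 := hxy.symm.zpow_zpow n m'
    have a4 := (Commute.refl y).zpow_zpow n n'
    exact (a1.mul_right a2).mul_left (a3.mul_right a4)
  generalize x ^ m * y ^ n = z at hg hz
  generalize x ^ m' * y ^ n' = z' at hh hz
  rw [comm_iff]
  have hzz : Commute (z : FTau ⧸ N) (z' : FTau ⧸ N) := hz.map (QuotientGroup.mk' N)
  have eg : (g : FTau ⧸ N) = (z : FTau ⧸ N)⁻¹ * ((z * g : FTau) : FTau ⧸ N) := by simp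
  have eh : (h : FTau ⧸ N) = (z' : FTau ⧸ N)⁻¹ * ((z' * h : FTau) : FTau ⧸ N) := by simp
  have h1 : Commute (z : FTau ⧸ N)⁻¹ (h : FTau ⧸ N) := by
    rw [eh]
    exact hzz.inv_inv.mul_right (hcen z _ hh).inv_left
  rw [eg]
  exact h1.mul_left (hcen h _ hg).symm

/-- The commutator subgroup of the group of compactly supported elements is that of `F_τ`. -/
noncomputable def commutatorEquiv : commutator compactlySupported ≃* commutator FTau :=
  ((commutator compactlySupported).equivMapOfInjective compactlySupported.subtype
    compactlySupported.subtype_injective).trans (MulEquiv.subgroupCongr (by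
      rw [commutator_eq, commutator_def, Subgroup.map_commutator, ← MonoidHom.range_eq_map,
        Subgroup.range_subtype]))

end FTau

theorem corollary3p3 :
    IsUniformlySimple 6 (commutator FTau) ∧ IsUniformlyPerfect 2 (commutator FTau) :=
  ⟨FTau.isProximalAction.isUniformlySimple.of_mulEquiv FTau.commutatorEquiv,
    FTau.isProximalAction.isUniformlyPerfect.of_mulEquiv FTau.commutatorEquiv⟩
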